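/- Let $-1<q<1$ and $\mathcal H=\ell^2(\mathbb Z)$ with canonical orthonormal basis $(e_i)_{i\in\mathbb Z}$, inner products being linear in the first variable. Let $\mathcal F_q$ be the $q$-deformed Fock space, that is, the Hilbert space completion of the linear span of a vacuum vector $\Omega$ and the algebraic tensors $f_1\otimes\cdots\otimes f_n$ ($n\ge 1$, $f_j\in\mathcal H$) with respect to the inner product for which $\Omega$ is a unit vector orthogonal to all tensors with $n\ge1$ and $$\langle f_1\otimes\cdots\otimes f_n,\ g_1\otimes\cdots\otimes g_m\rangle_q=\delta_{n,m}\sum_{\pi\in S_n}q^{i(\pi)}\langle f_1,g_{\pi(1)}\rangle\cdots\langle f_n,g_{\pi(n)}\rangle ,$$ where $S_n$ is the symmetric group and $i(\pi)$ is the number of inversions of $\pi$. For $i\in\mathbb Z$ let $a_i^+\in\mathcal B(\mathcal F_q)$ be the creator, determined by $a_i^+\Omega=e_i$ and $a_i^+(f_1\otimes\cdots\otimes f_n)=e_i\otimes f_1\otimes\cdots\otimes f_n$, and let the annihilator $a_i$ be its adjoint, so that $a_i\Omega=0$ and $$a_i(f_1\otimes\cdots\otimes f_n)=\sum_{k=1}^n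 q^{k-1}\langle f_k,e_i\rangle\, f_1\otimes\cdots\otimes f_{k-1}\otimes f_{k+1}\otimes\cdots\otimes f_n .$$ Let $\mathcal R_q\subseteq\mathcal B(\mathcal F_q)$ be the $C^*$-algebra generated by $\{a_i: i\in\mathbb Z\}$. Then the von Neumann algebra $\mathcal R_q''$ (the double commutant of $\mathcal R_q$ in $\mathcal B(\mathcal F_q)$) is all of $\mathcal B(\mathcal F_q)$. -/

import Mathlib

open scoped TensorProduct DirectSum InnerProductSpace ComplexConjugate ComplexOrder

noncomputable section

namespace QFock

/-- The one-particle space `ℓ²(ℤ)`. -/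
abbrev OneParticle : Type := lp (fun _ : ℤ => ℂ) 2

/-- The canonical unit vector `e_i` of `ℓ²(ℤ)`. -/
def basisVec (i : ℤ) : OneParticle := lp.single 2 i (1 : ℂ)

/-- The number of inversions of a permutation. -/
def inversions {n : ℕ} (π : Equiv.Perm (Fin n)) : ℕ :=
  (Finset.univ.filter fun p : Fin n × Fin n => p.1 < p.2 ∧ π p.2 < π p.1).card

/-- The `q`-inner product of the simple tensors `f_1 ⊗ ⋯ ⊗ f_n` and `g_1 ⊗ ⋯ ⊗ g_n`. With the
convention `⟪·, ·⟫` linear in the second variable, it is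
`∑_π q^{i(π)} ⟪f_{π(1)}, g_1⟫ ⋯ ⟪f_{π(n)}, g_n⟫`. -/
def kernel (q : ℝ) {n : ℕ} (f g : Fin n → OneParticle) : ℂ :=
  ∑ π : Equiv.Perm (Fin n), (q : ℂ) ^ inversions π * ∏ j, ⟪f (π j), g j⟫_ℂ

/-- `kernel` as a multilinear map of the second family of vectors. -/
def kernelMultilinear (q : ℝ) {n : ℕ} (f : Fin n → OneParticle) :
    MultilinearMap ℂ (fun _ : Fin n => OneParticle) ℂ :=
  ∑ π : Equiv.Perm (Fin n), (q : ℂ) ^ inversions π •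
    (MultilinearMap.mkPiAlgebra ℂ (Fin n) ℂ).compLinearMap
      (fun j => (innerSL ℂ (f (π j))).toLinearMap)

theorem kernelMultilinear_apply (q : ℝ) {n : ℕ} (f g : Fin n → OneParticle) :
    kernelMultilinear q f g = kernel q f g := by
  simp [kernelMultilinear, kernel]

theorem inversions_inv {n : ℕ} (π : Equiv.Perm (Fin n)) : inversions π⁻¹ = inversions π := by
  unfold inversions
  refine Finset.card_bij' (fun p _ => (π⁻¹ p.2, π⁻¹ p.1)) (fun p _ => (π p.2, π p.1)) ?_ ?_ ?_ ?_
  all_goals simp +contextual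

theorem kernel_conj (q : ℝ) {n : ℕ} (f g : Fin n → OneParticle) :
    conj (kernel q f g) = kernel q g f := by
  unfold kernel
  rw [map_sum, ← Equiv.sum_comp (Equiv.inv (Equiv.Perm (Fin n)))]
  refine Finset.sum_congr rfl fun π _ => ?_
  simp only [Equiv.inv_apply, inversions_inv, map_mul, map_pow, Complex.conj_ofReal, map_prod,
    inner_conj_symm]
  congr 1
  rw [← Equiv.prod_comp π]
  simp

theorem kernelMultilinear_update_add (q : ℝ) {n : ℕ} [DecidableEq (Fin n)]
    (g : Fin n → OneParticle) (i : Fin n) (x y : OneParticle) :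
    kernelMultilinear q (Function.update g i (x + y)) =
      kernelMultilinear q (Function.update g i x) + kernelMultilinear q (Function.update g i y) := by
  ext f
  rw [add_apply]
  simp only [kernelMultilinear_apply]
  rw [← kernel_conj, ← kernelMultilinear_apply, MultilinearMap.map_update_add]
  simp only [kernelMultilinear_apply, map_add, kernel_conj]

theorem kernelMultilinear_update_smul (q : ℝ) {n : ℕ} [DecidableEq (Fin n)]
    (g : Fin n → OneParticle) (i : Fin n) (c : ℂ) (x : OneParticle) :
    kernelMultilinear q (Function.update g i (c • x)) =
      conj c • kernelMultilinear q (Function.update g i x) := by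
  ext f
  rw [smul_apply]
  simp only [kernelMultilinear_apply]
  rw [← kernel_conj, ← kernelMultilinear_apply, MultilinearMap.map_update_smul]
  simp only [kernelMultilinear_apply, smul_eq_mul, map_mul, kernel_conj]

/-- The `q`-inner product on the `n`-particle tensors; antilinear in the first argument. -/
def nForm (q : ℝ) (n : ℕ) :
    (⨂[ℂ]^n OneParticle) →ₗ⋆[ℂ] (⨂[ℂ]^n OneParticle) →ₗ[ℂ] ℂ :=
  LinearMap.flip <| PiTensorProduct.lift
    { toFun := fun g => (starLinearEquiv ℂ (A := ℂ)).toLinearMap.comp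
        (PiTensorProduct.lift (kernelMultilinear q g))
      map_update_add' := by
        intro _ g i x y
        ext t
        simp [kernelMultilinear_update_add]
      map_update_smul' := by
        intro _ g i c x
        ext t
        simp [kernelMultilinear_update_smul] }

theorem nForm_tprod (q : ℝ) {n : ℕ} (f g : Fin n → OneParticle) :
    nForm q n (PiTensorProduct.tprod ℂ f) (PiTensorProduct.tprod ℂ g) = kernel q f g := by
  simp [nForm, kernelMultilinear_apply, kernel_conj]

theorem nForm_conj (q : ℝ) (n : ℕ) (x y : ⨂[ℂ]^n OneParticle) :
    conj (nForm q n x y) = nForm q n y x := by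
  induction x using PiTensorProduct.induction_on with
  | smul_tprod r f =>
    induction y using PiTensorProduct.induction_on with
    | smul_tprod s g =>
      simp only [map_smulₛₗ, LinearMap.smul_apply, nForm_tprod, smul_eq_mul, map_mul, kernel_conj,
        RingHom.id_apply, Complex.conj_conj]
      ring
    | add y z hy hz => simp only [map_add, LinearMap.add_apply, hy, hz]
  | add x z hx hz => simp only [map_add, LinearMap.add_apply, hx, hz]

theorem inversions_mul_inv {n : ℕ} (σ τ : Equiv.Perm (Fin n)) :
    inversions (σ * τ⁻¹) =
      (Finset.univ.filter fun p : Fin n × Fin n =>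
        p.1 < p.2 ∧ ¬ (σ p.1 < σ p.2 ↔ τ p.1 < τ p.2)).card := by
  have h1 : inversions (σ * τ⁻¹) = (Finset.univ.filter fun p : Fin n × Fin n =>
      τ p.1 < τ p.2 ∧ σ p.2 < σ p.1).card := by
    unfold inversions
    refine Finset.card_bij' (fun p _ => (τ⁻¹ p.1, τ⁻¹ p.2)) (fun p _ => (τ p.1, τ p.2)) ?_ ?_ ?_ ?_
    · intro p hp
      have hp := (Finset.mem_filter.1 hp).2
      refine Finset.mem_filter.2 ⟨Finset.mem_univ _, ?_, hp.2⟩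
      simpa using hp.1
    · intro p hp
      have hp := (Finset.mem_filter.1 hp).2
      refine Finset.mem_filter.2 ⟨Finset.mem_univ _, hp.1, ?_⟩
      simpa using hp.2
    · intro p _
      simp
    · intro p _
      simp
  rw [h1]
  refine Finset.card_bij' (fun p _ => if p.1 < p.2 then p else p.swap)
    (fun p _ => if τ p.1 < τ p.2 then p else p.swap) ?_ ?_ ?_ ?_
  · rintro ⟨a, b⟩ h
    have hab : a ≠ b := by rintro rfl; simp at h
    have hσ : σ a ≠ σ b := σ.injective.ne hab
    have hτ : τ a ≠ τ b := τ.injective.ne hab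
    simp only [Finset.mem_filter, Finset.mem_univ, true_and] at h ⊢
    split_ifs <;> grind
  · rintro ⟨a, b⟩ h
    have hab : a ≠ b := by rintro rfl; simp at h
    have hσ : σ a ≠ σ b := σ.injective.ne hab
    have hτ : τ a ≠ τ b := τ.injective.ne hab
    simp only [Finset.mem_filter, Finset.mem_univ, true_and] at h ⊢
    split_ifs <;> grind
  · rintro ⟨a, b⟩ h
    simp only [Finset.mem_filter, Finset.mem_univ, true_and] at h ⊢
    grind
  · rintro ⟨a, b⟩ h
    have hab : a ≠ b := by rintro rfl; simp at h
    have hτ : τ a ≠ τ b := τ.injective.ne hab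
    simp only [Finset.mem_filter, Finset.mem_univ, true_and] at h ⊢
    grind

theorem posSemidef_prod {ι κ : Type*} (s : Finset κ) (A : κ → Matrix ι ι ℂ)
    (h1 : (Matrix.of fun _ _ : ι => (1 : ℂ)).PosSemidef)
    (hA : ∀ k, (A k).PosSemidef) : (Matrix.of fun i j => ∏ k ∈ s, A k i j).PosSemidef := by
  classical
  induction s using Finset.induction_on with
  | empty => simpa using h1
  | insert k s hk ih =>
    have e : (Matrix.of fun i j => ∏ k ∈ insert k s, A k i j) =
        (A k).hadamard (Matrix.of fun i j => ∏ k ∈ s, A k i j) := by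
      ext i j
      simp [Finset.prod_insert hk]
    rw [e]
    exact (hA k).hadamard ih

/-- The kernel `1` or `q`, according to whether two truth values agree, is positive. -/
theorem posSemidef_agree {q : ℝ} (hq : q ∈ Set.Ioo (-1 : ℝ) 1) {ι : Type*} [Finite ι]
    (P : ι → Prop) [DecidablePred P] :
    (Matrix.of fun i j => if ¬ (P i ↔ P j) then (q : ℂ) else 1).PosSemidef := by
  have h0 := (Matrix.posSemidef_gram ℂ (fun _ : ι => (1 : ℂ))).smul
    (a := (1 + q) / 2) (by linarith [hq.1])
  have h1 := (Matrix.posSemidef_gram ℂ (fun i : ι => if P i then (1 : ℂ) else -1)).smul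
    (a := (1 - q) / 2) (by linarith [hq.2])
  have e : (Matrix.of fun i j => if ¬ (P i ↔ P j) then (q : ℂ) else 1) =
      ((1 + q) / 2) • Matrix.gram ℂ (fun _ : ι => (1 : ℂ)) +
        ((1 - q) / 2) • Matrix.gram ℂ (fun i : ι => if P i then (1 : ℂ) else -1) := by
    ext i j
    by_cases hi : P i <;> by_cases hj : P j <;> simp [hi, hj] <;> ring
  rw [e]
  exact h0.add h1

theorem posSemidef_perm {q : ℝ} (hq : q ∈ Set.Ioo (-1 : ℝ) 1) {n : ℕ} {ι : Type*} [Finite ι]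
    (σ : ι → Equiv.Perm (Fin n)) :
    (Matrix.of fun a b => (q : ℂ) ^ inversions (σ a * (σ b)⁻¹)).PosSemidef := by
  classical
  have := posSemidef_prod (Finset.univ.filter fun p : Fin n × Fin n => p.1 < p.2)
    (fun p => Matrix.of fun a b : ι =>
      if ¬ (σ a p.1 < σ a p.2 ↔ σ b p.1 < σ b p.2) then (q : ℂ) else 1)
    (by simpa [Matrix.gram] using! Matrix.posSemidef_gram ℂ (fun _ : ι => (1 : ℂ)))
    (fun p => posSemidef_agree hq (fun a => σ a p.1 < σ a p.2))
  convert this using 1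
  ext a b
  simp only [Matrix.of_apply, inversions_mul_inv]
  rw [Finset.prod_ite, Finset.prod_const, Finset.prod_const_one, mul_one, Finset.filter_filter]

theorem nForm_nonneg {q : ℝ} (hq : q ∈ Set.Ioo (-1 : ℝ) 1) (n : ℕ) (x : ⨂[ℂ]^n OneParticle) :
    0 ≤ nForm q n x x := by
  classical
  obtain ⟨c, rfl⟩ := Finsupp.mem_span_range_iff_exists_finsupp.1
    (show x ∈ Submodule.span ℂ (Set.range (PiTensorProduct.tprod ℂ)) by
      rw [PiTensorProduct.span_tprod_eq_top]; trivial)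
  let ι := c.support × Equiv.Perm (Fin n)
  have hM : (Matrix.of fun a b : ι => (q : ℂ) ^ inversions (a.2 * b.2⁻¹) *
      ∏ j, ⟪a.1.1 (a.2 j), b.1.1 (b.2 j)⟫_ℂ).PosSemidef := by
    have h2 := posSemidef_prod Finset.univ
      (fun j => Matrix.gram ℂ fun a : ι => a.1.1 (a.2 j))
      (by simpa [Matrix.gram] using! Matrix.posSemidef_gram ℂ (fun _ : ι => (1 : ℂ)))
      (fun j => Matrix.posSemidef_gram ℂ _)
    exact (posSemidef_perm hq (fun a : ι => a.2)).hadamard h2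
  have h := hM.dotProduct_mulVec_nonneg (fun a : ι => c a.1.1)
  have key : (∑ a : ι, ∑ b : ι, conj (c a.1.1) * ((q : ℂ) ^ inversions (a.2 * b.2⁻¹) *
      (∏ j, ⟪a.1.1 (a.2 j), b.1.1 (b.2 j)⟫_ℂ) * c b.1.1)) =
      (n.factorial : ℂ) * ∑ f ∈ c.support, ∑ g ∈ c.support,
        conj (c f) * (c g * kernel q f g) := by
    have hk : ∀ f g : Fin n → OneParticle, ∑ σ : Equiv.Perm (Fin n), ∑ τ : Equiv.Perm (Fin n),
        (q : ℂ) ^ inversions (σ * τ⁻¹) * ∏ j, ⟪f (σ j), g (τ j)⟫_ℂ =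
          (n.factorial : ℂ) * kernel q f g := by
      intro f g
      rw [Finset.sum_comm]
      have : ∀ τ : Equiv.Perm (Fin n), ∑ σ : Equiv.Perm (Fin n),
          (q : ℂ) ^ inversions (σ * τ⁻¹) * ∏ j, ⟪f (σ j), g (τ j)⟫_ℂ = kernel q f g := by
        intro τ
        rw [← Equiv.sum_comp (Equiv.mulRight τ)]
        refine Finset.sum_congr rfl fun π _ => ?_
        simp only [Equiv.coe_mulRight, mul_inv_cancel_right, Equiv.Perm.mul_apply]
        rw [Equiv.prod_comp τ (fun j => ⟪f (π j), g j⟫_ℂ)]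
      simp [this, Fintype.card_perm]
    rw [Fintype.sum_prod_type]
    have hι : ∀ F : ι → ℂ, ∑ b : ι, F b = ∑ g : c.support, ∑ τ, F (g, τ) :=
      fun F => Fintype.sum_prod_type F
    simp only [hι]
    rw [← Finset.sum_coe_sort c.support, Finset.mul_sum]
    refine Finset.sum_congr rfl fun f _ => ?_
    rw [Finset.sum_comm, ← Finset.sum_coe_sort c.support, Finset.mul_sum]
    refine Finset.sum_congr rfl fun g _ => ?_
    have := hk f g
    calc _ = conj (c f) * (c g * ∑ σ : Equiv.Perm (Fin n), ∑ τ : Equiv.Perm (Fin n),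
        (q : ℂ) ^ inversions (σ * τ⁻¹) * ∏ j, ⟪f.1 (σ j), g.1 (τ j)⟫_ℂ) := by
          simp only [Finset.mul_sum]
          refine Finset.sum_congr rfl fun σ _ => Finset.sum_congr rfl fun τ _ => ?_
          ring
      _ = _ := by rw [this]; ring
  have h' : 0 ≤ (n.factorial : ℂ) * ∑ f ∈ c.support, ∑ g ∈ c.support,
        conj (c f) * (c g * kernel q f g) := by
    rw [← key]
    convert h using 1
    simp only [dotProduct, Matrix.mulVec, Finset.mul_sum]
    rfl
  have hf : (0 : ℂ) < n.factorial := by exact_mod_cast n.factorial_pos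
  have h'' : 0 ≤ ∑ f ∈ c.support, ∑ g ∈ c.support, conj (c f) * (c g * kernel q f g) := by
    have := mul_nonneg (inv_nonneg.2 hf.le) h'
    rwa [inv_mul_cancel_left₀ hf.ne'] at this
  convert h'' using 1
  simp only [Finsupp.sum, map_sum, map_smulₛₗ, LinearMap.sum_apply, LinearMap.smul_apply,
    nForm_tprod, smul_eq_mul, RingHom.id_apply, Finset.mul_sum]
  rw [Finset.sum_comm]
  refine Finset.sum_congr rfl fun f _ => Finset.sum_congr rfl fun g _ => ?_
  ring

/-- The algebraic Fock space: finite sums of tensors over `ℓ²(ℤ)`, the degree `0` part `⨂[ℂ]^0`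
being spanned by the vacuum. -/
def AlgFock (_q : Set.Ioo (-1 : ℝ) 1) : Type := ⨁ n : ℕ, ⨂[ℂ]^n OneParticle

variable (q : Set.Ioo (-1 : ℝ) 1)

instance : AddCommGroup (AlgFock q) :=
  inferInstanceAs (AddCommGroup (⨁ n : ℕ, ⨂[ℂ]^n OneParticle))

instance : Module ℂ (AlgFock q) :=
  inferInstanceAs (Module ℂ (⨁ n : ℕ, ⨂[ℂ]^n OneParticle))

/-- The inclusion of the `n`-particle tensors in the algebraic Fock space. -/
def ofTensor (n : ℕ) : (⨂[ℂ]^n OneParticle) →ₗ[ℂ] AlgFock q :=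
  DirectSum.lof ℂ ℕ (fun n => ⨂[ℂ]^n OneParticle) n

/-- The `n`-particle component of an element of the algebraic Fock space. -/
def component (n : ℕ) : AlgFock q →ₗ[ℂ] (⨂[ℂ]^n OneParticle) :=
  DirectSum.component ℂ ℕ (fun n => ⨂[ℂ]^n OneParticle) n

/-- The linear map on the algebraic Fock space given by linear maps on the `n`-particle tensors. -/
def liftTensor {E : Type*} [AddCommGroup E] [Module ℂ E]
    (F : ∀ n : ℕ, (⨂[ℂ]^n OneParticle) →ₗ[ℂ] E) : AlgFock q →ₗ[ℂ] E :=
  DirectSum.toModule ℂ ℕ E F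

@[simp]
theorem liftTensor_ofTensor {E : Type*} [AddCommGroup E] [Module ℂ E]
    (F : ∀ n : ℕ, (⨂[ℂ]^n OneParticle) →ₗ[ℂ] E) (n : ℕ) (t : ⨂[ℂ]^n OneParticle) :
    liftTensor q F (ofTensor q n t) = F n t :=
  DirectSum.toModule_lof ℂ (M := fun n : ℕ => ⨂[ℂ]^n OneParticle) (φ := F) n t

@[simp]
theorem component_ofTensor_self (n : ℕ) (t : ⨂[ℂ]^n OneParticle) :
    component q n (ofTensor q n t) = t :=
  DirectSum.component.lof_self ℂ (M := fun n : ℕ => ⨂[ℂ]^n OneParticle) n t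

theorem component_ofTensor_of_ne {m n : ℕ} (h : n ≠ m) (t : ⨂[ℂ]^n OneParticle) :
    component q m (ofTensor q n t) = 0 := by
  have := DirectSum.component.of ℂ (M := fun n => ⨂[ℂ]^n OneParticle) m n t
  rw [dif_neg h] at this
  exact this

variable {q} in
theorem algFock_hom_ext {E : Type*} [AddCommGroup E] [Module ℂ E] {F G : AlgFock q →ₗ[ℂ] E}
    (h : ∀ (n : ℕ) (f : Fin n → OneParticle),
      F (ofTensor q n (PiTensorProduct.tprod ℂ f)) = G (ofTensor q n (PiTensorProduct.tprod ℂ f))) :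
    F = G := by
  refine DirectSum.linearMap_ext ℂ fun n => PiTensorProduct.ext ?_
  ext f
  exact h n f

variable {q} in
theorem algFock_induction {P : AlgFock q → Prop} (x : AlgFock q) (zero : P 0)
    (of : ∀ n t, P (ofTensor q n t)) (add : ∀ x y, P x → P y → P (x + y)) : P x :=
  DirectSum.induction_on x zero of add

/-- The `q`-inner product `⟨x, y⟩_q = ∑ n, ⟨x_n, y_n⟩_q`, antilinear in `x`. -/
def qInner (x y : AlgFock q) : ℂ := liftTensor q (fun n => nForm q n (component q n x)) y

theorem qInner_add_left (x y z : AlgFock q) :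
    qInner q (x + y) z = qInner q x z + qInner q y z := by
  have : liftTensor q (fun n => nForm q n (component q n (x + y))) =
      liftTensor q (fun n => nForm q n (component q n x)) +
        liftTensor q (fun n => nForm q n (component q n y)) := by
    apply algFock_hom_ext
    simp
  exact congrArg (fun F => F z) this

theorem qInner_smul_left (x y : AlgFock q) (c : ℂ) :
    qInner q (c • x) y = conj c * qInner q x y := by
  have : liftTensor q (fun n => nForm q n (component q n (c • x))) =
      conj c • liftTensor q (fun n => nForm q n (component q n x)) := by
    apply algFock_hom_ext
    simp
  exact congrArg (fun F => F y) this

theorem qInner_add_right (x y z : AlgFock q) :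
    qInner q x (y + z) = qInner q x y + qInner q x z := map_add _ _ _

theorem qInner_ofTensor_right (x : AlgFock q) (n : ℕ) (t : ⨂[ℂ]^n OneParticle) :
    qInner q x (ofTensor q n t) = nForm q n (component q n x) t := by
  simp [qInner]

theorem qInner_zero_right (x : AlgFock q) : qInner q x 0 = 0 := map_zero _

theorem qInner_zero_left (x : AlgFock q) : qInner q 0 x = 0 := by
  simpa using qInner_smul_left q 0 x 0

theorem qInner_conj (x y : AlgFock q) : conj (qInner q y x) = qInner q x y := by
  induction x using algFock_induction with
  | zero => simp [qInner_zero_left, qInner_zero_right]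
  | add x z hx hz => rw [qInner_add_left, qInner_add_right, map_add, hx, hz]
  | of n t =>
    induction y using algFock_induction with
    | zero => simp [qInner_zero_left, qInner_zero_right]
    | add x z hx hz => rw [qInner_add_left, qInner_add_right, map_add, hx, hz]
    | of m s =>
      rw [qInner_ofTensor_right, qInner_ofTensor_right]
      by_cases h : n = m
      · subst h
        simp [nForm_conj]
      · rw [component_ofTensor_of_ne q h, component_ofTensor_of_ne q (Ne.symm h)]
        simp

theorem qInner_self_nonneg (x : AlgFock q) : 0 ≤ qInner q x x := by
  classical
  have : qInner q x x = ∑ n ∈ DFinsupp.support (β := fun n => ⨂[ℂ]^n OneParticle) x,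
      nForm q n (component q n x) (component q n x) := by
    conv_lhs => rw [qInner]
    have hx : x = ∑ n ∈ DFinsupp.support (β := fun n => ⨂[ℂ]^n OneParticle) x,
        ofTensor q n (component q n x) :=
      (DirectSum.sum_support_of (β := fun n => ⨂[ℂ]^n OneParticle) x).symm
    conv_lhs => arg 2; rw [hx]
    rw [map_sum]
    simp
  rw [this]
  exact Finset.sum_nonneg fun n _ => nForm_nonneg q.2 n _

/-- The `q`-inner product makes the algebraic Fock space a (semi-)inner product space. -/
@[reducible]
def qCore : PreInnerProductSpace.Core ℂ (AlgFock q) where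
  inner := qInner q
  conj_inner_symm := qInner_conj q
  re_inner_nonneg x := (Complex.nonneg_iff.1 (qInner_self_nonneg q x)).1
  add_left := qInner_add_left q
  smul_left x y c := qInner_smul_left q x y c

instance : SeminormedAddCommGroup (AlgFock q) :=
  InnerProductSpace.Core.toSeminormedAddCommGroup (c := qCore q)

instance : InnerProductSpace ℂ (AlgFock q) := InnerProductSpace.ofCore (qCore q)

theorem inner_eq (x y : AlgFock q) : ⟪x, y⟫_ℂ = qInner q x y := rfl

theorem inner_ofTensor_tprod {m n : ℕ} (f : Fin m → OneParticle) (g : Fin n → OneParticle) :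
    ⟪ofTensor q m (PiTensorProduct.tprod ℂ f), ofTensor q n (PiTensorProduct.tprod ℂ g)⟫_ℂ =
      if h : m = n then kernel q (fun j => f (Fin.cast h.symm j)) g else 0 := by
  rw [inner_eq, qInner_ofTensor_right]
  split_ifs with h
  · subst h
    simp [nForm_tprod]
  · rw [component_ofTensor_of_ne q h]
    simp

/-- The `q`-deformed Fock space `F_q`. -/
abbrev FockSpace : Type := UniformSpace.Completion (AlgFock q)


/-- The map `f_1 ⊗ ⋯ ⊗ f_n ↦ f ⊗ f_1 ⊗ ⋯ ⊗ f_n`. -/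
def consTensor (f : OneParticle) (n : ℕ) :
    (⨂[ℂ]^n OneParticle) →ₗ[ℂ] (⨂[ℂ]^(n + 1) OneParticle) :=
  PiTensorProduct.lift
    ((PiTensorProduct.tprod ℂ (s := fun _ : Fin (n + 1) => OneParticle)).curryLeft f)

@[simp]
theorem consTensor_tprod (f : OneParticle) {n : ℕ} (g : Fin n → OneParticle) :
    consTensor f n (PiTensorProduct.tprod ℂ g) = PiTensorProduct.tprod ℂ (Fin.cons f g) := by
  simp [consTensor]

/-- The map `g_1 ⊗ ⋯ ⊗ g_{n+1} ↦ ∑_k q^{k-1} ⟨f, g_k⟩ g_1 ⊗ ⋯ ⊗ g_{k-1} ⊗ g_{k+1} ⊗ ⋯ ⊗ g_{n+1}`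
(with `k` counted from `0` in the code). -/
def contractTensor (f : OneParticle) (n : ℕ) :
    (⨂[ℂ]^(n + 1) OneParticle) →ₗ[ℂ] (⨂[ℂ]^n OneParticle) :=
  ∑ k : Fin (n + 1), (q : ℂ) ^ (k : ℕ) • PiTensorProduct.lift
    (LinearMap.uncurryMid (M := fun _ => OneParticle) k
      ((innerSL ℂ f).toLinearMap.smulRight
        (PiTensorProduct.tprod ℂ (s := fun _ : Fin n => OneParticle))))

theorem contractTensor_tprod (f : OneParticle) {n : ℕ} (g : Fin (n + 1) → OneParticle) :
    contractTensor q f n (PiTensorProduct.tprod ℂ g) =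
      ∑ k : Fin (n + 1), ((q : ℂ) ^ (k : ℕ) * ⟪f, g k⟫_ℂ) •
        PiTensorProduct.tprod ℂ (k.removeNth g) := by
  simp [contractTensor, mul_smul]

/-- The creator on the algebraic Fock space. -/
def algCreator (f : OneParticle) : AlgFock q →ₗ[ℂ] AlgFock q :=
  liftTensor q fun n => (ofTensor q (n + 1)).comp (consTensor f n)

/-- The annihilator on the algebraic Fock space; it kills the vacuum. -/
def algAnnihilator (f : OneParticle) : AlgFock q →ₗ[ℂ] AlgFock q :=
  liftTensor q fun n =>
    match n with
    | 0 => 0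
    | n + 1 => (ofTensor q n).comp (contractTensor q f n)

/-- The permutation sending `k` to `0` and the other places to the places `1, …, n` through `σ`. -/
def permOf {n : ℕ} (p : Fin (n + 1) × Equiv.Perm (Fin n)) : Equiv.Perm (Fin (n + 1)) :=
  Equiv.Perm.decomposeFin.symm (0, p.2) * p.1.cycleRange

@[simp] theorem permOf_self {n : ℕ} (p : Fin (n + 1) × Equiv.Perm (Fin n)) :
    permOf p p.1 = 0 := by
  simp [permOf]

@[simp] theorem permOf_succAbove {n : ℕ} (p : Fin (n + 1) × Equiv.Perm (Fin n)) (j : Fin n) :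
    permOf p (p.1.succAbove j) = (p.2 j).succ := by
  simp [permOf]

theorem permOf_bijective {n : ℕ} : Function.Bijective (permOf (n := n)) := by
  rw [Fintype.bijective_iff_injective_and_card]
  constructor
  · rintro ⟨k, σ⟩ ⟨l, τ⟩ h
    have hk : k = l := by
      apply (permOf (l, τ)).injective
      rw [← h, permOf_self (k, σ), h, permOf_self (l, τ)]
    subst hk
    congr 1
    ext j
    have h1 := permOf_succAbove (k, σ) j
    rw [h, permOf_succAbove (k, τ) j] at h1
    have := Fin.succ_injective _ h1
    simp at this
    rw [this]
  · simp [Fintype.card_perm, Nat.factorial_succ]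

theorem inversions_eq_sum {n : ℕ} (π : Equiv.Perm (Fin n)) :
    inversions π = ∑ a, ∑ b, if a < b ∧ π b < π a then 1 else 0 := by
  rw [inversions, Finset.card_filter, Fintype.sum_prod_type]

theorem inversions_permOf {n : ℕ} (p : Fin (n + 1) × Equiv.Perm (Fin n)) :
    inversions (permOf p) = p.1 + inversions p.2 := by
  rw [inversions_eq_sum, inversions_eq_sum, Fin.sum_univ_succAbove _ p.1]
  simp_rw [Fin.sum_univ_succAbove _ p.1]
  simp [Finset.sum_add_distrib, (Fin.strictMono_succAbove p.1).lt_iff_lt]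
  have h : ∀ x : Fin n, p.1.succAbove x < p.1 ↔ (x : ℕ) < (p.1 : ℕ) := fun x => by
    rw [Fin.succAbove_lt_iff_castSucc_lt, Fin.lt_def, Fin.val_castSucc]
  simp only [h]
  have hp : (p.1 : ℕ) ≤ n := Nat.lt_succ_iff.1 p.1.2
  rw [Fin.card_filter_val_lt]
  omega

theorem kernel_cons (f : OneParticle) {n : ℕ} (g : Fin n → OneParticle)
    (h : Fin (n + 1) → OneParticle) :
    kernel q (Fin.cons f g) h =
      ∑ k : Fin (n + 1), ((q : ℂ) ^ (k : ℕ) * ⟪f, h k⟫_ℂ) * kernel q g (k.removeNth h) := by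
  conv_lhs => rw [kernel]
  rw [← permOf_bijective.sum_comp, Fintype.sum_prod_type]
  refine Finset.sum_congr rfl fun k _ => ?_
  rw [kernel, Finset.mul_sum]
  refine Finset.sum_congr rfl fun σ _ => ?_
  rw [inversions_permOf, Fin.prod_univ_succAbove _ k, permOf_self (k, σ)]
  simp only [permOf_succAbove (k, σ), Fin.cons_zero, Fin.cons_succ, Fin.removeNth_apply]
  ring

theorem qInner_smul_right (x y : AlgFock q) (c : ℂ) :
    qInner q x (c • y) = c * qInner q x y := map_smul _ _ _

@[simp]
theorem algCreator_tprod (f : OneParticle) {n : ℕ} (g : Fin n → OneParticle) :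
    algCreator q f (ofTensor q n (PiTensorProduct.tprod ℂ g)) =
      ofTensor q (n + 1) (PiTensorProduct.tprod ℂ (Fin.cons f g)) := by
  simp [algCreator]

@[simp]
theorem algAnnihilator_vacuum (f : OneParticle) (t : ⨂[ℂ]^0 OneParticle) :
    algAnnihilator q f (ofTensor q 0 t) = 0 := by
  simp [algAnnihilator]

theorem algAnnihilator_tprod (f : OneParticle) {n : ℕ} (g : Fin (n + 1) → OneParticle) :
    algAnnihilator q f (ofTensor q (n + 1) (PiTensorProduct.tprod ℂ g)) =
      ∑ k : Fin (n + 1), ((q : ℂ) ^ (k : ℕ) * ⟪f, g k⟫_ℂ) •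
        ofTensor q n (PiTensorProduct.tprod ℂ (k.removeNth g)) := by
  simp [algAnnihilator, contractTensor_tprod]

variable {q} in
theorem algFock_induction_tprod {P : AlgFock q → Prop} (x : AlgFock q) (zero : P 0)
    (tprod : ∀ (n : ℕ) (f : Fin n → OneParticle) (c : ℂ),
      P (c • ofTensor q n (PiTensorProduct.tprod ℂ f)))
    (add : ∀ x y, P x → P y → P (x + y)) : P x := by
  induction x using algFock_induction with
  | zero => exact zero
  | add x y hx hy => exact add x y hx hy
  | of n t =>
    induction t using PiTensorProduct.induction_on with
    | smul_tprod c f =>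
      rw [map_smul]
      exact tprod n f c
    | add s t hs ht =>
      rw [map_add]
      exact add _ _ hs ht

theorem qInner_algCreator (f : OneParticle) (x y : AlgFock q) :
    qInner q (algCreator q f x) y = qInner q x (algAnnihilator q f y) := by
  induction x using algFock_induction_tprod with
  | zero => simp [qInner_zero_left]
  | add x z hx hz => rw [map_add, qInner_add_left, qInner_add_left, hx, hz]
  | tprod m g c =>
    rw [map_smul, qInner_smul_left, qInner_smul_left]
    congr 1
    induction y using algFock_induction_tprod with
    | zero => simp [qInner_zero_right]
    | add x z hx hz => rw [map_add, qInner_add_right, qInner_add_right, hx, hz]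
    | tprod n h d =>
      rw [map_smul, qInner_smul_right, qInner_smul_right]
      congr 1
      rw [algCreator_tprod, qInner_ofTensor_right]
      cases n with
      | zero =>
        rw [component_ofTensor_of_ne q (Nat.succ_ne_zero m), algAnnihilator_vacuum,
          qInner_zero_right]
        simp
      | succ n =>
        rw [algAnnihilator_tprod, qInner, map_sum]
        simp only [map_smul, liftTensor_ofTensor]
        by_cases hmn : m = n
        · subst hmn
          simp [nForm_tprod, kernel_cons]
        · rw [component_ofTensor_of_ne q (by omega), component_ofTensor_of_ne q hmn]
          simp

theorem algAnnihilator_algCreator (f : OneParticle) (x : AlgFock q) :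
    algAnnihilator q f (algCreator q f x) =
      (q : ℂ) • algCreator q f (algAnnihilator q f x) + ⟪f, f⟫_ℂ • x := by
  induction x using algFock_induction_tprod with
  | zero => simp
  | add x z hx hz => simp only [map_add, hx, hz, smul_add]; abel
  | tprod n g c =>
    simp only [map_smul]
    rw [smul_comm _ c, smul_comm _ c, ← smul_add]
    congr 1
    rw [algCreator_tprod, algAnnihilator_tprod, Fin.sum_univ_succ]
    have h0 : (0 : Fin (n + 1)).removeNth (α := fun _ => OneParticle) (Fin.cons f g) = g := by
      ext j
      simp [Fin.removeNth]
    rw [h0, add_comm]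
    congr 1
    · cases n with
      | zero => simp
      | succ n =>
        rw [algAnnihilator_tprod, map_sum, Finset.smul_sum]
        refine Finset.sum_congr rfl fun k _ => ?_
        have hk : (k.succ).removeNth (α := fun _ => OneParticle) (Fin.cons f g) =
            Fin.cons f (k.removeNth g) := by
          funext j
          refine Fin.cases ?_ (fun j => ?_) j <;> simp [Fin.removeNth]
        rw [hk, map_smul, algCreator_tprod, smul_smul]
        simp only [Fin.val_succ, Fin.cons_succ]
        congr 1
        ring
    · simp

theorem component_algAnnihilator (f : OneParticle) (m : ℕ) (x : AlgFock q) :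
    component q m (algAnnihilator q f x) = contractTensor q f m (component q (m + 1) x) := by
  have : (component q m).comp (algAnnihilator q f) =
      (contractTensor q f m).comp (component q (m + 1)) := by
    apply algFock_hom_ext
    intro n g
    cases n with
    | zero => simp [component_ofTensor_of_ne q (Nat.succ_ne_zero m).symm]
    | succ n =>
      simp only [LinearMap.comp_apply, algAnnihilator, liftTensor_ofTensor]
      by_cases h : n = m
      · subst h
        simp
      · rw [component_ofTensor_of_ne q h, component_ofTensor_of_ne q (by omega), map_zero]
  exact congrArg (fun F => F x) this

theorem exists_degree (x : AlgFock q) : ∃ n, ∀ m ≥ n, component q m x = 0 := by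
  induction x using algFock_induction with
  | zero => exact ⟨0, fun m _ => map_zero _⟩
  | of n t => exact ⟨n + 1, fun m hm => component_ofTensor_of_ne q (by omega) t⟩
  | add x y hx hy =>
    obtain ⟨a, ha⟩ := hx
    obtain ⟨b, hb⟩ := hy
    exact ⟨max a b, fun m hm => by
      rw [map_add, ha m (le_trans (le_max_left _ _) hm), hb m (le_trans (le_max_right _ _) hm),
        add_zero]⟩

variable {q} in
theorem eq_zero_of_component (x : AlgFock q) (h : ∀ m, component q m x = 0) : x = 0 :=
  DFinsupp.ext h

theorem abs_lt_one : |(q : ℝ)| < 1 := abs_lt.2 q.2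

theorem norm_algCreator_sq_le (f : OneParticle) (n : ℕ) (x : AlgFock q)
    (hx : ∀ m ≥ n, component q m x = 0) :
    ‖algCreator q f x‖ ^ 2 ≤ (1 - |(q : ℝ)|)⁻¹ * ‖f‖ ^ 2 * ‖x‖ ^ 2 := by
  have hq := abs_lt_one q
  have hpos : 0 < 1 - |(q : ℝ)| := by linarith
  induction n generalizing x with
  | zero =>
    rw [eq_zero_of_component x (fun m => hx m (Nat.zero_le m))]
    simp
  | succ n ih =>
    set N := algAnnihilator q f x with hN
    have hNV : ∀ m ≥ n, component q m N = 0 := fun m hm => by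
      rw [hN, component_algAnnihilator, hx (m + 1) (by omega), map_zero]
    have h1 := ih N hNV
    have adj : ∀ u v : AlgFock q, ⟪algCreator q f u, v⟫_ℂ = ⟪u, algAnnihilator q f v⟫_ℂ :=
      qInner_algCreator q f
    have e1 : ‖algCreator q f x‖ ^ 2 = q * ‖N‖ ^ 2 + ‖f‖ ^ 2 * ‖x‖ ^ 2 := by
      have : (‖algCreator q f x‖ ^ 2 : ℂ) = q * ‖N‖ ^ 2 + ‖f‖ ^ 2 * ‖x‖ ^ 2 := by
        have a1 := inner_self_eq_norm_sq_to_K (𝕜 := ℂ) (algCreator q f x)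
        have a2 := inner_self_eq_norm_sq_to_K (𝕜 := ℂ) N
        have a3 := inner_self_eq_norm_sq_to_K (𝕜 := ℂ) x
        have a4 := inner_self_eq_norm_sq_to_K (𝕜 := ℂ) f
        have a5 : ⟪x, algCreator q f N⟫_ℂ = ⟪N, N⟫_ℂ := by
          rw [← inner_conj_symm, adj, ← hN, inner_conj_symm]
        rw [adj, algAnnihilator_algCreator, inner_add_right, inner_smul_right, inner_smul_right,
          ← hN, a5, a2, a3, a4] at a1
        exact a1.symm
      exact_mod_cast this
    have e2 : ‖N‖ ^ 2 ≤ ‖algCreator q f N‖ * ‖x‖ := by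
      have : ⟪algCreator q f N, x⟫_ℂ = ⟪N, N⟫_ℂ := adj _ _
      rw [inner_self_eq_norm_sq_to_K] at this
      have h2 := norm_inner_le_norm (𝕜 := ℂ) (algCreator q f N) x
      rw [this] at h2
      simpa using h2
    set C := (1 - |(q : ℝ)|)⁻¹ * ‖f‖ ^ 2 with hC
    have hC0 : 0 ≤ C := by positivity
    have e3 : ‖N‖ ^ 2 ≤ C * ‖x‖ ^ 2 := by
      rcases eq_or_lt_of_le (sq_nonneg ‖N‖) with h | h
      · rw [← h]; positivity
      · have h3 : (‖N‖ ^ 2) ^ 2 ≤ (C * ‖N‖ ^ 2) * ‖x‖ ^ 2 := by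
          calc (‖N‖ ^ 2) ^ 2 ≤ (‖algCreator q f N‖ * ‖x‖) ^ 2 := by gcongr
            _ = ‖algCreator q f N‖ ^ 2 * ‖x‖ ^ 2 := by ring
            _ ≤ _ := by gcongr
        refine le_of_mul_le_mul_left ?_ h
        linarith
    have e4 : (q : ℝ) * ‖N‖ ^ 2 ≤ |(q : ℝ)| * (C * ‖x‖ ^ 2) :=
      mul_le_mul (le_abs_self _) e3 (sq_nonneg _) (abs_nonneg _)
    have e5 : C = |(q : ℝ)| * C + ‖f‖ ^ 2 := by
      rw [hC]
      field_simp
      ring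
    rw [e1]
    calc _ ≤ |(q : ℝ)| * (C * ‖x‖ ^ 2) + ‖f‖ ^ 2 * ‖x‖ ^ 2 := by linarith
      _ = (|(q : ℝ)| * C + ‖f‖ ^ 2) * ‖x‖ ^ 2 := by ring
      _ = _ := by rw [← e5]

theorem norm_algCreator_le (f : OneParticle) (x : AlgFock q) :
    ‖algCreator q f x‖ ≤ √(1 - |(q : ℝ)|)⁻¹ * ‖f‖ * ‖x‖ := by
  obtain ⟨n, hn⟩ := exists_degree q x
  have h := norm_algCreator_sq_le q f n x hn
  have hpos : 0 ≤ (1 - |(q : ℝ)|)⁻¹ := inv_nonneg.2 (by linarith [abs_lt_one q])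
  refine abs_le_of_sq_le_sq' ?_ (by positivity) |>.2
  rw [mul_pow, mul_pow, Real.sq_sqrt hpos]
  exact h

/-- The creator `a^+(f)` on `F_q`, the continuous extension of
`f_1 ⊗ ⋯ ⊗ f_n ↦ f ⊗ f_1 ⊗ ⋯ ⊗ f_n`. -/
def creator (f : OneParticle) : FockSpace q →L[ℂ] FockSpace q :=
  ((algCreator q f).mkContinuous _ (norm_algCreator_le q f)).completion

/-- The annihilator `a(f)` on `F_q`, the adjoint of the creator `a^+(f)`. -/
def annihilator (f : OneParticle) : FockSpace q →L[ℂ] FockSpace q :=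
  ContinuousLinearMap.adjoint (creator q f)

/-- The simple tensor `f_1 ⊗ ⋯ ⊗ f_n` as a vector of `F_q`. -/
def simpleTensor {n : ℕ} (f : Fin n → OneParticle) : FockSpace q :=
  ((ofTensor q n (PiTensorProduct.tprod ℂ f) : AlgFock q) : FockSpace q)

/-- The vacuum vector `Ω`. -/
def vacuum : FockSpace q := simpleTensor q ![]

theorem creator_coe (f : OneParticle) (x : AlgFock q) :
    creator q f (x : FockSpace q) = (algCreator q f x : AlgFock q) :=
  ContinuousLinearMap.completion_apply_coe _ _

theorem annihilator_coe (f : OneParticle) (x : AlgFock q) :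
    annihilator q f (x : FockSpace q) = (algAnnihilator q f x : AlgFock q) := by
  refine UniformSpace.Completion.denseRange_coe.eq_of_inner_right ℂ fun y => ?_
  rw [annihilator, ContinuousLinearMap.adjoint_inner_right, creator_coe,
    UniformSpace.Completion.inner_coe, UniformSpace.Completion.inner_coe]
  exact qInner_algCreator q f y x

theorem inner_simpleTensor {m n : ℕ} (f : Fin m → OneParticle) (g : Fin n → OneParticle) :
    ⟪simpleTensor q f, simpleTensor q g⟫_ℂ =
      if h : m = n then kernel q (fun j => f (Fin.cast h.symm j)) g else 0 := by
  rw [simpleTensor, simpleTensor, UniformSpace.Completion.inner_coe, inner_ofTensor_tprod]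

theorem creator_simpleTensor (f : OneParticle) {n : ℕ} (g : Fin n → OneParticle) :
    creator q f (simpleTensor q g) = simpleTensor q (Fin.cons f g) := by
  rw [simpleTensor, creator_coe, algCreator_tprod, simpleTensor]

theorem annihilator_vacuum (f : OneParticle) : annihilator q f (vacuum q) = 0 := by
  rw [vacuum, simpleTensor, annihilator_coe, algAnnihilator_vacuum,
    UniformSpace.Completion.coe_zero]

theorem annihilator_simpleTensor (f : OneParticle) {n : ℕ} (g : Fin (n + 1) → OneParticle) :
    annihilator q f (simpleTensor q g) =
      ∑ k : Fin (n + 1), ((q : ℂ) ^ (k : ℕ) * ⟪f, g k⟫_ℂ) • simpleTensor q (k.removeNth g) := by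
  rw [simpleTensor, annihilator_coe, algAnnihilator_tprod]
  simp only [← UniformSpace.Completion.coe_toComplL (𝕜 := ℂ), map_sum, map_smul, simpleTensor]

/-- The `C*`-algebra `R_q` generated by the annihilators `a_i = a(e_i)`, `i ∈ ℤ`. -/
def algebraR : StarSubalgebra ℂ (FockSpace q →L[ℂ] FockSpace q) :=
  (StarAlgebra.adjoin ℂ (Set.range fun i : ℤ => annihilator q (basisVec i))).topologicalClosure

/-- The von Neumann algebra `R_q''`, the double commutant of `R_q` in `B(F_q)`. -/
def vonNeumannR : VonNeumannAlgebra (FockSpace q) where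
  toSubalgebra := Subalgebra.centralizer ℂ
    (Set.centralizer (algebraR q : Set (FockSpace q →L[ℂ] FockSpace q)))
  star_mem' := by
    intro T hT S hS
    have hS' : star S ∈ Set.centralizer (algebraR q : Set (FockSpace q →L[ℂ] FockSpace q)) := by
      intro A hA
      have := hS (star A) (star_mem hA)
      have := congrArg star this
      simpa using this.symm
    have := congrArg star (hT (star S) hS')
    simpa using this.symm
  centralizer_centralizer' := Set.centralizer_centralizer_centralizer _

theorem coe_vonNeumannR : (vonNeumannR q : Set (FockSpace q →L[ℂ] FockSpace q)) =
    Set.centralizer (Set.centralizer (algebraR q : Set (FockSpace q →L[ℂ] FockSpace q))) := rfl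

end QFock
end

noncomputable section

namespace QFock

variable (q : Set.Ioo (-1 : ℝ) 1)

/-! The double commutant is everything as soon as the commutant of `algebraR` consists of scalars,
since scalars commute with every bounded operator. So the point is that creators and annihilators
act irreducibly.

Let `T` commute with all of them. Then `T Ω` is killed by every annihilator, because `a(f) T Ω = T
a(f) Ω = 0`. A vector killed by every `a(f)` is orthogonal to the range of every `a⁺(f)`, hence to
every simple tensor of positive degree, so it is a multiple of `Ω`; thus `T Ω = c Ω`. Creators carry
`Ω` to all simple tensors and commute with `T`, so `T` acts as `c` on each of them, and their span
is dense. This is `eq_smul_one_of_commute`.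

That argument peels an arbitrary vector `f` off a simple tensor, whereas membership in the commutant
only concerns `f = e_i`. The gap is closed by `commute_creator`, which uses that `f ↦ a⁺(f)` is
linear and bounded (`creatorL`). Beyond the construction of `F_q`, the assumption `|q| < 1` enters
only through this boundedness. -/

/-! ### Totality of the simple tensors -/

/-- Two continuous linear maps on the Fock space agreeing on the simple tensors are equal. -/
theorem fock_hom_ext {E : Type*} [AddCommGroup E] [Module ℂ E] [TopologicalSpace E] [T2Space E]
    {F G : FockSpace q →L[ℂ] E}
    (h : ∀ (n : ℕ) (f : Fin n → OneParticle), F (simpleTensor q f) = G (simpleTensor q f)) :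
    F = G := by
  have key : ∀ x : AlgFock q, F (x : FockSpace q) = G (x : FockSpace q) := fun x => by
    induction x using algFock_induction_tprod with
    | zero => rw [UniformSpace.Completion.coe_zero, map_zero, map_zero]
    | add x y hx hy => rw [UniformSpace.Completion.coe_add, map_add, map_add, hx, hy]
    | tprod n f c =>
      rw [UniformSpace.Completion.coe_smul, map_smul, map_smul]
      exact congrArg (c • ·) (h n f)
  ext x
  induction x using UniformSpace.Completion.induction_on with
  | hp => exact isClosed_eq F.continuous G.continuous
  | ih x => exact key x

/-- The functional `⟪v, ·⟫` vanishes on a total set, hence everywhere, in particular at `v` itself.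
-/
theorem eq_zero_of_inner_simpleTensor {v : FockSpace q}
    (h : ∀ (n : ℕ) (f : Fin n → OneParticle), ⟪v, simpleTensor q f⟫_ℂ = 0) : v = 0 := by
  have : innerSL ℂ v = 0 := fock_hom_ext q fun n f => by simpa using h n f
  simpa using congrArg (fun F => F v) this

/-! ### Dependence of the creator on its one-particle vector -/

/-- The creator `a^+(f)` as a continuous linear function of `f`. -/
def creatorL : OneParticle →L[ℂ] (FockSpace q →L[ℂ] FockSpace q) :=
  LinearMap.mkContinuous
    { toFun := creator q
      map_add' := fun f g => fock_hom_ext q fun n h => by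
        -- Linearity in `f` comes from the algebraic map that prepends `f`, multilinear in all its
        -- slots.
        have e : consTensor (f + g) n = consTensor f n + consTensor g n := by
          simp [consTensor]
        have := congrArg (fun F => ofTensor q (n + 1) (F (PiTensorProduct.tprod ℂ h))) e
        simp only [LinearMap.add_apply, map_add, consTensor_tprod] at this
        rw [add_apply, creator_simpleTensor, creator_simpleTensor, creator_simpleTensor]
        simp only [simpleTensor, this, UniformSpace.Completion.coe_add]
      map_smul' := fun c f => fock_hom_ext q fun n h => by
        have e : consTensor (c • f) n = c • consTensor f n := by
          simp [consTensor]
        have := congrArg (fun F => ofTensor q (n + 1) (F (PiTensorProduct.tprod ℂ h))) e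
        simp only [LinearMap.smul_apply, map_smul, consTensor_tprod] at this
        rw [smul_apply, creator_simpleTensor, creator_simpleTensor]
        simp only [simpleTensor, this, UniformSpace.Completion.coe_smul, RingHom.id_apply] }
    -- The constant is the one in `norm_algCreator_le`. The bound holds on the dense algebraic Fock
    -- space and is a closed condition.
    (√(1 - |(q : ℝ)|)⁻¹) fun f => by
      refine ContinuousLinearMap.opNorm_le_bound _ (by positivity) fun x => ?_
      induction x using UniformSpace.Completion.induction_on with
      | hp => exact isClosed_le (by fun_prop) (by fun_prop)
      | ih x =>
        change ‖creator q f x‖ ≤ _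
        rw [creator_coe, UniformSpace.Completion.norm_coe, UniformSpace.Completion.norm_coe]
        exact norm_algCreator_le q f x

@[simp]
theorem creatorL_apply (f : OneParticle) : creatorL q f = creator q f := rfl

theorem oneParticle_hom_ext {E : Type*} [AddCommGroup E] [Module ℂ E] [TopologicalSpace E]
    [T2Space E] {F G : OneParticle →L[ℂ] E} (h : ∀ i, F (basisVec i) = G (basisVec i)) : F = G := by
  -- The side goal is `2 ≠ ∞`: finitely supported sequences are dense in `ℓ^p` only for finite `p`.
  refine lp.ext_continuousLinearMap (by norm_num) fun i => ?_
  ext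
  exact h i

variable {q}

/-- Both `f ↦ T a⁺(f)` and `f ↦ a⁺(f) T` are continuous and linear, so agreement on the `e_i` is
enough. -/
theorem commute_creator {T : FockSpace q →L[ℂ] FockSpace q}
    (h : ∀ i, Commute T (creator q (basisVec i))) (f : OneParticle) :
    Commute T (creator q f) := by
  have : (ContinuousLinearMap.mul ℂ _ T).comp (creatorL q) =
      ((ContinuousLinearMap.mul ℂ _).flip T).comp (creatorL q) :=
    oneParticle_hom_ext fun i => h i
  exact congrArg (fun F => F f) this

/-! ### Triviality of the commutant -/

/-- An operator commuting with all creators and annihilators is a scalar. -/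
theorem eq_smul_one_of_commute {T : FockSpace q →L[ℂ] FockSpace q}
    (hc : ∀ f, Commute T (creator q f)) (ha : ∀ f, Commute T (annihilator q f)) :
    ∃ c : ℂ, T = c • 1 := by
  have hΩ : ∀ f : Fin 0 → OneParticle, simpleTensor q f = vacuum q := fun f => by
    rw [vacuum, Subsingleton.elim f ![]]
  have hΩ1 : ⟪vacuum q, vacuum q⟫_ℂ = 1 := by
    rw [vacuum, inner_simpleTensor]
    simp [kernel, inversions]
  -- The only possible scalar, as `Ω` is a unit vector; this choice makes `T Ω - c Ω` orthogonal to
  -- `Ω`.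
  set c := ⟪vacuum q, T (vacuum q)⟫_ℂ with hcdef
  have hann : ∀ f, annihilator q f (T (vacuum q) - c • vacuum q) = 0 := fun f => by
    have := congrArg (fun S => S (vacuum q)) (ha f).eq
    simp only [mul_apply_eq_comp, annihilator_vacuum, map_zero] at this
    rw [map_sub, map_smul, annihilator_vacuum, ← this, smul_zero, sub_zero]
  have hTΩ : T (vacuum q) = c • vacuum q := by
    rw [← sub_eq_zero]
    refine eq_zero_of_inner_simpleTensor q fun n f => ?_
    rw [inner_eq_zero_symm]
    cases n with
    | zero => rw [hΩ, inner_sub_right, inner_smul_right, hΩ1, mul_one, sub_self]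
    | succ n =>
      -- A tensor of positive degree is `a⁺(f 0)` applied to its tail. Moving the creator across the
      -- inner product gives `a(f 0)`, which kills `T Ω - c Ω`.
      rw [← Fin.cons_self_tail f, ← creator_simpleTensor,
        ← ContinuousLinearMap.adjoint_inner_right]
      exact (congrArg _ (hann _)).trans (inner_zero_right _)
  refine ⟨c, fock_hom_ext q fun n f => ?_⟩
  induction n with
  | zero => simpa [hΩ] using hTΩ
  | succ n ih =>
    -- `T` passes through `a⁺(f 0)` and acts as `c` on the tail by induction.
    have h1 := congrArg (fun S => S (simpleTensor q (Fin.tail f))) (hc (f 0)).eq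
    simp only [mul_apply_eq_comp, ih (Fin.tail f)] at h1
    rw [← Fin.cons_self_tail f, ← creator_simpleTensor, h1]
    simp

/-- The commutant of `R_q` consists of scalars. -/
theorem eq_smul_one_of_mem_centralizer {T : FockSpace q →L[ℂ] FockSpace q}
    (hT : T ∈ Set.centralizer (algebraR q : Set (FockSpace q →L[ℂ] FockSpace q))) :
    ∃ c : ℂ, T = c • 1 := by
  have hmem : ∀ i, annihilator q (basisVec i) ∈ algebraR q := fun i =>
    StarSubalgebra.le_topologicalClosure _ (StarAlgebra.subset_adjoin ℂ _ ⟨i, rfl⟩)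
  have hstar : ∀ f, star (annihilator q f) = creator q f := fun f =>
    ContinuousLinearMap.adjoint_adjoint _
  have h1 := commute_creator (T := T) fun i => by
    rw [← hstar]
    exact (hT _ (star_mem (hmem i))).symm
  -- Since `f ↦ a(f)` is conjugate-linear, the extension lemma is applied to `star T` and creators
  -- instead; taking adjoints afterwards returns `T` and `a(f)`.
  have h2 := commute_creator (T := star T) fun i => by
    rw [← hstar]
    exact Commute.star_star (hT _ (hmem i)).symm
  refine eq_smul_one_of_commute h1 fun f => ?_
  have := (h2 f).star_star
  rwa [star_star, ← hstar, star_star] at this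

end QFock

end

theorem mainTheorem4 (q : ℝ) (hq₁ : -1 < q) (hq₂ : q < 1) :
    (QFock.vonNeumannR ⟨q, hq₁, hq₂⟩ :
      Set (QFock.FockSpace ⟨q, hq₁, hq₂⟩ →L[ℂ] QFock.FockSpace ⟨q, hq₁, hq₂⟩)) = Set.univ := by
  rw [QFock.coe_vonNeumannR, Set.eq_univ_iff_forall]
  intro S T hT
  -- The arbitrary operator `S` only has to commute with the scalar `c • 1`.
  obtain ⟨c, rfl⟩ := QFock.eq_smul_one_of_mem_centralizer hT
  simp
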